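/- Let $p$ be a prime. For a finite simplicial graph $\Gamma$, the right-angled Artin pro-$p$ group $G_\Gamma$ is the pro-$p$ completion of the right-angled Artin group $\langle V(\Gamma)\mid [u,v]=1 \text{ for } \{u,v\}\in E(\Gamma)\rangle$. Let $L_3$ be the path with four vertices $x,y,z,w$ (in this order), so that $G=G_{L_3}$ has the pro-$p$ presentation $\langle x,y,z,w\mid [x,y]=[y,z]=[z,w]=1\rangle$. Write $g^h=h^{-1}gh$, and let $\langle S\rangle$ denote the closed subgroup topologically generated by $S$. For a pro-$p$ group $H$, let $H^{ab}$ be the quotient of $H$ by the closure of its commutator subgroup; a pro-$p$ group is absolutely torsion free if $H^{ab}$ is torsion free for each of its closed subgroups $H$. Then $G$ is not absolutely torsion free. More precisely, consider the closed subgroups $$V_1=\langle yz,\ yz^x,\ y^p\rangle,\qquad V=\langle yz,\ yz^x,\ y^p,\ wx\rangle$$ of $G$ and put $t=wx\in V$. Then: 1. $z^p,(z^x)^p\in V_1$, there is an injective continuous homomorphism $f:\langle z^p\rangle\to V_1$ with $f(z^p)=(z^x)^p$, and $V$, with the inclusion $V_1\hookrightarrow V$ and the stable letter $t$, is the pro-$p$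 HNN extension $\mathrm{HNN}(V_1,(z^p)^t=(z^x)^p,t)$. That is, $V$ is a pro-$p$ group, $a^t=f(a)$ for all $a\in\langle z^p\rangle$, and for every pro-$p$ group $K$, every continuous homomorphism $\varphi:V_1\to K$ and every $s\in K$ with $s^{-1}\varphi(a)s=\varphi(f(a))$ for all $a\in\langle z^p\rangle$, there is a unique continuous homomorphism $\psi:V\to K$ with $\psi|_{V_1}=\varphi$ and $\psi(t)=s$. 2. $V^{ab}\cong\mathbb Z_p\oplus\mathbb Z_p\oplus\mathbb Z_p\oplus C_p$ as topological groups, where $C_p$ is the cyclic group of order $p$. -/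

import Mathlib

open scoped commutatorElement

universe u

/-! ### Right-angled Artin groups and their pro-`p` completions -/

/-- The right-angled Artin group of a simplicial graph `Γ`: generated by the vertices, subject to
the relations `[u, v] = 1` for `u`, `v` adjacent. -/
abbrev RightAngledArtinGroup {V : Type*} (Γ : SimpleGraph V) : Type _ :=
  PresentedGroup
    {r : FreeGroup V | ∃ u v : V, Γ.Adj u v ∧ r = ⁅FreeGroup.of u, FreeGroup.of v⁆}

/-- The normal subgroups of `p`-power index of an abstract group. -/
def PPowIndexNormal (p : ℕ) (G : Type*) [Group G] : Type _ :=
  {N : Subgroup G // N.Normal ∧ ∃ n : ℕ, N.index = p ^ n}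

instance PPowIndexNormal.instNormal {p : ℕ} {G : Type*} [Group G] (N : PPowIndexNormal p G) :
    N.1.Normal := N.2.1

/-- The finite quotient `G / N`, for `N` normal of `p`-power index. -/
def PPowQuotient {p : ℕ} {G : Type*} [Group G] (N : PPowIndexNormal p G) : Type _ := G ⧸ N.1

instance PPowQuotient.instGroup {p : ℕ} {G : Type*} [Group G] (N : PPowIndexNormal p G) :
    Group (PPowQuotient N) := inferInstanceAs (Group (G ⧸ N.1))

/-- `G / N` carries the discrete topology. -/
instance PPowQuotient.instTopologicalSpace {p : ℕ} {G : Type*} [Group G]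
    (N : PPowIndexNormal p G) : TopologicalSpace (PPowQuotient N) := ⊥

instance PPowQuotient.instDiscreteTopology {p : ℕ} {G : Type*} [Group G]
    (N : PPowIndexNormal p G) : DiscreteTopology (PPowQuotient N) := ⟨rfl⟩

/-- The projection `G → G / N`. -/
def PPowQuotient.mk {p : ℕ} {G : Type*} [Group G] (N : PPowIndexNormal p G) :
    G →* PPowQuotient N := QuotientGroup.mk' N.1

/-- The transition map `G / N → G / M` for `N ≤ M`. -/
def PPowQuotient.map {p : ℕ} {G : Type*} [Group G] {N M : PPowIndexNormal p G} (h : N.1 ≤ M.1) :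
    PPowQuotient N →* PPowQuotient M :=
  QuotientGroup.map N.1 M.1 (MonoidHom.id G) h

/-- The pro-`p` completion of `G` as the inverse limit of the quotients `G / N`, inside their
product. -/
def proPCompletionSubgroup (p : ℕ) (G : Type*) [Group G] :
    Subgroup ((N : PPowIndexNormal p G) → PPowQuotient N) where
  carrier := {s | ∀ (N M : PPowIndexNormal p G) (h : N.1 ≤ M.1), PPowQuotient.map h (s N) = s M}
  mul_mem' {a b} ha hb N M h := by
    rw [Pi.mul_apply, Pi.mul_apply, map_mul, ha N M h, hb N M h]
  one_mem' N M h := by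
    rw [Pi.one_apply, Pi.one_apply, map_one]
  inv_mem' {a} ha N M h := by
    rw [Pi.inv_apply, Pi.inv_apply, map_inv, ha N M h]

/-- The pro-`p` completion of an abstract group, with the topology induced by the product topology
(discrete on each factor). -/
abbrev ProPCompletion (p : ℕ) (G : Type*) [Group G] : Type _ := ↥(proPCompletionSubgroup p G)

/-- The canonical homomorphism from a group to its pro-`p` completion. -/
def ProPCompletion.of (p : ℕ) (G : Type*) [Group G] : G →* ProPCompletion p G where
  toFun g := ⟨fun N => PPowQuotient.mk N g, fun _ _ _ => rfl⟩
  map_one' := Subtype.ext (funext fun N => map_one (PPowQuotient.mk N))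
  map_mul' a b := Subtype.ext (funext fun N => map_mul (PPowQuotient.mk N) a b)

/-- The right-angled Artin pro-`p` group `G_Γ` of a finite simplicial graph `Γ`. -/
abbrev RightAngledArtinProP (p : ℕ) {V : Type*} [Finite V] (Γ : SimpleGraph V) : Type _ :=
  ProPCompletion p (RightAngledArtinGroup Γ)

/-- The canonical generator of `G_Γ` attached to a vertex of `Γ`. -/
def RightAngledArtinProP.gen (p : ℕ) {V : Type*} [Finite V] (Γ : SimpleGraph V) (v : V) :
    RightAngledArtinProP p Γ :=
  ProPCompletion.of p (RightAngledArtinGroup Γ) (PresentedGroup.of v)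

/-! ### Closed subgroups and absolute torsion-freeness -/

/-- The closed subgroup (topologically) generated by a set. -/
def closedSubgroupGenerated {G : Type*} [Group G] [TopologicalSpace G] [IsTopologicalGroup G]
    (S : Set G) : Subgroup G :=
  (Subgroup.closure S).topologicalClosure

/-- Every closed subgroup has torsion free abelianization (the abelianization being the quotient by
the closure of the commutator subgroup). -/
def IsAbsolutelyTorsionFree (G : Type*) [Group G] [TopologicalSpace G] [IsTopologicalGroup G] :
    Prop :=
  ∀ H : Subgroup G, IsClosed (H : Set G) → IsMulTorsionFree (TopologicalAbelianization H)

/-! ### Pro-`p` groups and pro-`p` HNN extensions -/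

/-- `G` is a pro-`p` group: a profinite group all of whose open normal subgroups have `p`-power
index. -/
structure IsProP (p : ℕ) (G : Type*) [Group G] [TopologicalSpace G] : Prop where
  isTopologicalGroup : IsTopologicalGroup G
  compactSpace : CompactSpace G
  t2Space : T2Space G
  totallyDisconnectedSpace : TotallyDisconnectedSpace G
  index_eq_pow : ∀ N : Subgroup G, N.Normal → IsOpen (N : Set G) → ∃ n : ℕ, N.index = p ^ n

/-- `G`, with the homomorphism `ι : H → G` and the stable letter `t : G`, is the pro-`p` HNN
extension `HNN(H, a ^ t = f a (a ∈ A), t)` of the pro-`p` group `H` along the continuous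
monomorphism `f : A → H` defined on the closed subgroup `A` of `H`; here `a ^ t = t⁻¹ a t`.
It is characterized by its universal property among all pro-`p` groups. (That the extension is
proper, i.e. that `ι` is injective, is not part of this definition.) -/
structure IsProPHNNExtension (p : ℕ) {H G : Type*} [Group H] [TopologicalSpace H]
    [Group G] [TopologicalSpace G] (A : Subgroup H) (f : A →ₜ* H) (ι : H →ₜ* G) (t : G) :
    Prop where
  base_isProP : IsProP p H
  isProP : IsProP p G
  isClosed_associated : IsClosed (A : Set H)
  injective : Function.Injective f
  conj_eq : ∀ a : A, t⁻¹ * ι (a : H) * t = ι (f a)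
  existsUnique_lift : ∀ (K : Type u) [Group K] [TopologicalSpace K], IsProP p K →
    ∀ (φ : H →ₜ* K) (s : K), (∀ a : A, s⁻¹ * φ (a : H) * s = φ (f a)) →
      ∃! ψ : G →ₜ* K, (∀ h : H, ψ (ι h) = φ h) ∧ ψ t = s

/-! Put `u = yz`, `v = yz^x`, `q = y^p`, `t = wx`. In `G` one has `u^p q⁻¹ = z^p` and `v^p q⁻¹ =
(z^x)^p`. Since `w` commutes with `z`, these are conjugate under `t`; also `q` commutes with `u` and
`v`. Everything follows once `V` is known to be presented, as a pro-`p` group, by these relations,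
which is `exists_continuousMonoidHom_hnnSubgroup`.

The difficulty is to extend a prescription `u, v, q, t ↦ a, b, q, s` satisfying the relations to all
of `V`. A compactness argument (`IsProP.exists_continuousMonoidHom`) reduces to targets `K` that are
finite `p`-groups. There one constructs the induced homomorphism: `G` maps to `(ℤ/p)²` by `x, y, z,
w ↦ (1,0), (0,1), (0,-1), (-1,0)`, with `V` in the kernel. On the corresponding covering the edges
carry labels in `K` (`pathLabels`), giving a homomorphism from `G` to the wreath product of `K` with
`(ℤ/p)²`; its component at the base point restricts to the desired map on `V`.

The HNN property is then immediate. In `V^ab` the conjugacy relation becomes `u^p = v^p`, so `u/v`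
has order `p`, while `v, q, t` are free generators; this torsion refutes absolute torsion-freeness.
-/

/-! ### Topological generation. -/

section ClosedGeneration

variable {G K : Type*} [Group G] [TopologicalSpace G] [IsTopologicalGroup G]
  [Group K] [TopologicalSpace K]

theorem subset_closedSubgroupGenerated (S : Set G) : S ⊆ closedSubgroupGenerated S :=
  Subgroup.subset_closure.trans (Subgroup.le_topologicalClosure _)

theorem isClosed_closedSubgroupGenerated (S : Set G) :
    IsClosed (closedSubgroupGenerated S : Set G) :=
  Subgroup.isClosed_topologicalClosure _

theorem closedSubgroupGenerated_le {S : Set G} {H : Subgroup G} (hS : S ⊆ H)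
    (hH : IsClosed (H : Set G)) : closedSubgroupGenerated S ≤ H :=
  Subgroup.topologicalClosure_minimal _ ((Subgroup.closure_le H).2 hS) hH

/-- Allows maps on a generated subgroup to be compared on its generators, the subgroup being treated
as a group in its own right. -/
theorem closedSubgroupGenerated_preimage_eq_top (S : Set G) :
    closedSubgroupGenerated (Subtype.val ⁻¹' S : Set (closedSubgroupGenerated S)) = ⊤ := by
  rw [eq_top_iff]
  rintro v -
  let T : Subgroup (closedSubgroupGenerated S) := Subgroup.closure (Subtype.val ⁻¹' S)
  have himg : Subtype.val '' (T : Set (closedSubgroupGenerated S)) = Subgroup.closure S := by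
    have h := MonoidHom.map_closure (closedSubgroupGenerated S).subtype
      (Subtype.val ⁻¹' S : Set (closedSubgroupGenerated S))
    have h' : (closedSubgroupGenerated S).subtype ''
        (Subtype.val ⁻¹' S : Set (closedSubgroupGenerated S)) = S :=
      Set.image_preimage_eq_of_subset fun s hs => ⟨⟨s, subset_closedSubgroupGenerated S hs⟩, rfl⟩
    rw [h'] at h
    exact congrArg (fun H : Subgroup G => (H : Set G)) h
  refine closure_subtype.2 (?_ :
    (v : G) ∈ closure (Subtype.val '' (T : Set (closedSubgroupGenerated S))))
  rw [himg]
  exact v.2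

theorem MonoidHom.eqOn_closedSubgroupGenerated [T2Space K] {f g : G →* K} (hf : Continuous f)
    (hg : Continuous g) {S : Set G} (h : Set.EqOn f g S) :
    Set.EqOn f g (closedSubgroupGenerated S) := fun _ hv =>
  closedSubgroupGenerated_le (H := f.eqLocus g) h (isClosed_eq hf hg) hv

theorem ContinuousMonoidHom.ext_of_closedSubgroupGenerated_eq_top [T2Space K] {f g : G →ₜ* K}
    {S : Set G} (hS : closedSubgroupGenerated S = ⊤) (h : Set.EqOn f g S) : f = g := by
  ext v
  exact MonoidHom.eqOn_closedSubgroupGenerated (f := f.toMonoidHom) (g := g.toMonoidHom)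
    f.continuous_toFun g.continuous_toFun h (hS ▸ Subgroup.mem_top v)

end ClosedGeneration

/-! ### Pro-`p` groups and extension of maps from generators. -/

section ProP

open Filter Topology

variable {p : ℕ} {G K : Type*} [Group G] [TopologicalSpace G] [Group K] [TopologicalSpace K]

/-- Convergence of `p^n`-th powers to `1` passes directly to closed subgroups and products, which
makes it the convenient criterion. -/
theorem IsProP.of_tendsto_pow [Fact p.Prime] [IsTopologicalGroup G] [CompactSpace G] [T2Space G]
    [TotallyDisconnectedSpace G] (h : ∀ g : G, Tendsto (fun n : ℕ => g ^ p ^ n) atTop (𝓝 1)) :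
    IsProP p G where
  isTopologicalGroup := inferInstance
  compactSpace := inferInstance
  t2Space := inferInstance
  totallyDisconnectedSpace := inferInstance
  index_eq_pow N _ hN := by
    have : Finite (G ⧸ N) := Subgroup.quotient_finite_of_isOpen N hN
    have hp : IsPGroup p (G ⧸ N) := by
      intro c
      obtain ⟨g, rfl⟩ := QuotientGroup.mk_surjective c
      obtain ⟨n, hn⟩ := ((h g).eventually (hN.mem_nhds N.one_mem)).exists
      exact ⟨n, by rw [← QuotientGroup.mk_pow]; exact (QuotientGroup.eq_one_iff _).2 hn⟩
    exact IsPGroup.iff_card.1 hp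

theorem IsProP.exists_openNormal_le (hG : IsProP p G) {U : Set G} (hU : U ∈ 𝓝 1) :
    ∃ N : Subgroup G, N.Normal ∧ IsOpen (N : Set G) ∧ (N : Set G) ⊆ U := by
  have := hG.isTopologicalGroup
  have := hG.compactSpace
  have := hG.t2Space
  have := hG.totallyDisconnectedSpace
  obtain ⟨W, hW, hWo, h1⟩ := mem_nhds_iff.1 hU
  obtain ⟨N, hN⟩ := ProfiniteGrp.exist_openNormalSubgroup_sub_open_nhds_of_one hWo h1
  exact ⟨N.toSubgroup, N.isNormal', N.isOpen', hN.trans hW⟩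

theorem IsProP.tendsto_pow (hG : IsProP p G) (g : G) :
    Tendsto (fun n : ℕ => g ^ p ^ n) atTop (𝓝 1) := by
  intro U hU
  obtain ⟨N, hN, hNo, hNU⟩ := hG.exists_openNormal_le hU
  obtain ⟨n, hn⟩ := hG.index_eq_pow N hN hNo
  refine mem_atTop_sets.2 ⟨n, fun m hm => hNU ?_⟩
  obtain ⟨k, rfl⟩ := Nat.exists_eq_add_of_le hm
  change g ^ p ^ (n + k) ∈ N
  rw [pow_add, pow_mul, ← hn]
  exact N.pow_mem (N.pow_index_mem g) _

theorem IsProP.subgroup [Fact p.Prime] (hG : IsProP p G) {H : Subgroup G}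
    (hH : IsClosed (H : Set G)) : IsProP p H := by
  have := hG.isTopologicalGroup
  have := hG.compactSpace
  have := hG.t2Space
  have := hG.totallyDisconnectedSpace
  have : CompactSpace H := isCompact_iff_compactSpace.1 hH.isCompact
  refine IsProP.of_tendsto_pow fun g => ?_
  rw [tendsto_subtype_rng]
  exact hG.tendsto_pow (g : G)

theorem IsProP.isPGroup_quotient [Fact p.Prime] (hG : IsProP p G) (N : Subgroup G) [N.Normal]
    (hN : IsOpen (N : Set G)) : IsPGroup p (G ⧸ N) := by
  obtain ⟨n, hn⟩ := hG.index_eq_pow N ‹_› hN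
  exact IsPGroup.of_card hn

/-- A prescription of images for topological generators extends to a continuous homomorphism to a
pro-`p` group as soon as it does so modulo every open normal subgroup. -/
theorem IsProP.exists_continuousMonoidHom (hK : IsProP p K) [IsTopologicalGroup G] [CompactSpace G]
    [T2Space G] {ι : Type*} (g : ι → G) (k : ι → K)
    (hg : closedSubgroupGenerated (Set.range g) = ⊤)
    (h : ∀ N : Subgroup K, ∀ [N.Normal], IsOpen (N : Set K) →
      ∃ ψ : G →* K ⧸ N, IsOpen (ψ.ker : Set G) ∧ ∀ i, ψ (g i) = k i) :
    ∃ ψ : G →ₜ* K, ∀ i, ψ (g i) = k i := by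
  have := hK.isTopologicalGroup
  have := hK.compactSpace
  have := hK.t2Space
  -- The candidate graph of the homomorphism. Its projection to `G` will be a continuous bijection
  -- from a compact group, hence a homeomorphism.
  set Γ : Subgroup (G × K) := closedSubgroupGenerated (Set.range fun i => (g i, k i)) with hΓ
  have hΓc : IsClosed (Γ : Set (G × K)) := isClosed_closedSubgroupGenerated _
  have : CompactSpace Γ := isCompact_iff_compactSpace.1 hΓc.isCompact
  have hmem : ∀ i, (g i, k i) ∈ Γ := fun i => subset_closedSubgroupGenerated _ ⟨i, rfl⟩
  let π : Γ →* G := (MonoidHom.fst G K).comp Γ.subtype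
  have hπc : Continuous π := continuous_fst.comp continuous_subtype_val
  have hsurj : Function.Surjective π := by
    rw [← MonoidHom.range_eq_top, eq_top_iff, ← hg]
    refine closedSubgroupGenerated_le ?_ (isCompact_range hπc).isClosed
    rintro _ ⟨i, rfl⟩
    exact ⟨⟨_, hmem i⟩, rfl⟩
  have hinj : Function.Injective π := by
    rw [injective_iff_map_eq_one]
    rintro ⟨⟨v, c⟩, hvc⟩ (rfl : v = 1)
    have hc : c = 1 := by
      by_contra hne
      obtain ⟨N, hN, hNo, hNc⟩ := hK.exists_openNormal_le (isOpen_compl_singleton.mem_nhds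
        (show (1 : K) ∈ ({c}ᶜ : Set K) from fun h => hne h.symm))
      obtain ⟨ψ, hψ, hψg⟩ := h N hNo
      -- The graph of `ψ` modulo `N`. It is open, hence closed, and contains the generators of `Γ`,
      -- so `(1, c) ∈ Γ` forces `c ∈ N`.
      let E : Subgroup (G × K) := (ψ.comp (MonoidHom.fst G K)).eqLocus
        ((QuotientGroup.mk' N).comp (MonoidHom.snd G K))
      have hE : IsOpen (E : Set (G × K)) := by
        refine Subgroup.isOpen_mono (H₁ := ψ.ker.prod N) ?_ ?_
        · rintro ⟨a, b⟩ ⟨ha, hb⟩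
          exact (MonoidHom.mem_ker.1 ha).trans ((QuotientGroup.eq_one_iff b).2 hb).symm
        · rw [Subgroup.coe_prod]
          exact hψ.prod hNo
      have hle : Γ ≤ E := closedSubgroupGenerated_le
        (by rintro _ ⟨i, rfl⟩; exact hψg i) (Subgroup.isClosed_of_isOpen _ hE)
      have h1 : ψ 1 = (c : K ⧸ N) := hle hvc
      rw [map_one] at h1
      exact hNc ((QuotientGroup.eq_one_iff c).1 h1.symm) rfl
    subst hc
    rfl
  let e : Γ ≃* G := MulEquiv.ofBijective π ⟨hinj, hsurj⟩
  have he : Continuous e.symm :=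
    Continuous.continuous_symm_of_equiv_compact_to_t2 (f := e.toEquiv) hπc
  refine ⟨⟨((MonoidHom.snd G K).comp Γ.subtype).comp e.symm.toMonoidHom,
    continuous_snd.comp (continuous_subtype_val.comp he)⟩, fun i => ?_⟩
  have : e.symm (g i) = ⟨_, hmem i⟩ := e.symm_apply_eq.2 rfl
  change (e.symm (g i)).1.2 = k i
  rw [this]

end ProP

/-! ### The pro-`p` completion and its maps to finite `p`-groups. -/

section Completion

open Filter

variable (p : ℕ) [Fact p.Prime] (R : Type*) [Group R]

instance PPowQuotient.instFinite {N : PPowIndexNormal p R} : Finite (PPowQuotient N) := by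
  obtain ⟨n, hn⟩ := N.2.2
  have : N.1.FiniteIndex := ⟨by rw [hn]; exact pow_ne_zero _ (Fact.out : p.Prime).ne_zero⟩
  exact inferInstanceAs (Finite (R ⧸ N.1))

theorem isClosed_proPCompletionSubgroup :
    IsClosed (proPCompletionSubgroup p R : Set ((N : PPowIndexNormal p R) → PPowQuotient N)) := by
  have : (proPCompletionSubgroup p R : Set ((N : PPowIndexNormal p R) → PPowQuotient N)) =
      ⋂ (N : PPowIndexNormal p R) (M : PPowIndexNormal p R) (h : N.1 ≤ M.1),
        {s | PPowQuotient.map h (s N) = s M} := by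
    ext s
    simp only [Set.mem_iInter]
    rfl
  rw [this]
  exact isClosed_iInter fun N => isClosed_iInter fun M => isClosed_iInter fun h =>
    isClosed_eq (continuous_of_discreteTopology.comp (continuous_apply N)) (continuous_apply M)

theorem ProPCompletion.isProP : IsProP p (ProPCompletion p R) := by
  refine IsProP.subgroup (IsProP.of_tendsto_pow fun g => ?_) (isClosed_proPCompletionSubgroup p R)
  refine tendsto_pi_nhds.2 fun N => ?_
  obtain ⟨n, hn⟩ := N.2.2
  refine tendsto_const_nhds.congr' ?_
  filter_upwards [eventually_ge_atTop n] with m hm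
  obtain ⟨k, rfl⟩ := Nat.exists_eq_add_of_le hm
  have hcard : Nat.card (PPowQuotient N) = p ^ n := hn
  rw [Pi.pow_apply, pow_add, pow_mul, ← hcard, pow_card_eq_one', one_pow, Pi.one_apply]

variable {p R}

/-- The kernel of `ρ` is itself an index of the inverse limit, so `ρ` factors through that discrete
coordinate. -/
theorem ProPCompletion.exists_monoidHom {L : Type*} [Group L] [Finite L] (hL : IsPGroup p L)
    (ρ : R →* L) : ∃ ψ : ProPCompletion p R →* L, IsOpen (ψ.ker : Set (ProPCompletion p R)) ∧
      ∀ r, ψ (ProPCompletion.of p R r) = ρ r := by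
  have hindex : ∃ n, ρ.ker.index = p ^ n := by
    obtain ⟨n, hn⟩ := IsPGroup.iff_card.1 (hL.to_subgroup ρ.range)
    exact ⟨n, by rw [Subgroup.index_ker, hn]⟩
  let N : PPowIndexNormal p R := ⟨ρ.ker, inferInstance, hindex⟩
  let κ : PPowQuotient N →* L := QuotientGroup.kerLift ρ
  let ev : ProPCompletion p R →* PPowQuotient N :=
    (Pi.evalMonoidHom _ N).comp (proPCompletionSubgroup p R).subtype
  have hev : Continuous ev := (continuous_apply N).comp continuous_subtype_val
  refine ⟨κ.comp ev, ?_, fun r => rfl⟩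
  exact (isOpen_discrete (κ ⁻¹' {1})).preimage hev

end Completion

/-! ### Labelled coverings as elements of a wreath product. -/

section Wreath

open Multiplicative RegularWreathProduct

variable {p : ℕ} {K : Type*} [Group K]

theorem RegularWreathProduct.mul_left_apply {D Q : Type*} [Group D] [Group Q] (g h : D ≀ᵣ Q)
    (c : Q) : (g * h).left c = g.left c * h.left (g.right⁻¹ * c) := rfl

theorem RegularWreathProduct.isPGroup {D Q : Type*} [Group D] [Group Q] [Finite D] [Finite Q]
    [Fact p.Prime] (hD : IsPGroup p D) (hQ : IsPGroup p Q) : IsPGroup p (D ≀ᵣ Q) := by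
  obtain ⟨m, hm⟩ := IsPGroup.iff_card.1 hD
  obtain ⟨n, hn⟩ := IsPGroup.iff_card.1 hQ
  refine IsPGroup.of_card (n := m * p ^ n + n) ?_
  rw [RegularWreathProduct.card, hm, hn, pow_add, pow_mul]

/-- The component at `1` of the elements of a wreath product lying over `1`. -/
def RegularWreathProduct.leftOne (D Q : Type*) [Group D] [Group Q] :
    (rightHom : D ≀ᵣ Q →* Q).ker →* D where
  toFun g := g.1.left 1
  map_one' := rfl
  map_mul' g h := by
    have hg : g.1.right = 1 := g.2
    simp [hg]

/-- The images of the generators of the right-angled Artin group of the path in a wreath product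
with `ℤ/p × ℤ/p`, read as labels on the edges of a covering: the column `j` of the covering
carries the commuting pair `q`, `a j`, and `σ j` conjugates `a j ^ p * q⁻¹` to
`a (j + 1) ^ p * q⁻¹`. -/
def pathLabels (p : ℕ) (q : K) (a σ : ZMod p → K) :
    Fin 4 → K ≀ᵣ Multiplicative (ZMod p × ZMod p) :=
  ![⟨1, ofAdd (1, 0)⟩,
    ⟨fun c => if (toAdd c).2 = 0 then q else 1, ofAdd (0, 1)⟩,
    ⟨fun c => if (toAdd c).2 = -1 then q⁻¹ * a (toAdd c).1 else a (toAdd c).1, ofAdd (0, -1)⟩,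
    ⟨fun c => (a (toAdd c).1 ^ (toAdd c).2.val)⁻¹ * σ (toAdd c).1 *
      a ((toAdd c).1 + 1) ^ (toAdd c).2.val, ofAdd (-1, 0)⟩]

variable {q : K} {a σ : ZMod p → K}

theorem commute_pathLabels_zero_one :
    Commute (pathLabels p q a σ 0) (pathLabels p q a σ 1) := by
  refine RegularWreathProduct.ext (funext fun c => ?_) (mul_comm _ _)
  simp [pathLabels]

theorem commute_pathLabels_one_two (hq : ∀ j, Commute q (a j)) :
    Commute (pathLabels p q a σ 1) (pathLabels p q a σ 2) := by
  refine RegularWreathProduct.ext (funext fun c => ?_) (mul_comm _ _)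
  have h := (hq (toAdd c).1).eq
  have h1 : -1 + (toAdd c).2 = -1 ↔ (toAdd c).2 = 0 := by simp
  have h2 : 1 + (toAdd c).2 = 0 ↔ (toAdd c).2 = -1 := by
    rw [add_comm, add_eq_zero_iff_eq_neg]
  simp only [pathLabels, mul_left_apply, Matrix.cons_val, ← ofAdd_neg, toAdd_mul, toAdd_ofAdd,
    Prod.neg_mk, neg_neg, Prod.fst_add, Prod.snd_add, neg_zero, zero_add, h1, h2]
  split_ifs <;> simp [mul_assoc]
  all_goals rw [← h]; simp

/-- At the vertex `(j, i)` with `i ≠ -1` the powers of `a j` and `a (j + 1)` telescope. At `i = -1`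
the exponent falls from `p - 1` back to `0`; the missing `p`-th powers, with the `q⁻¹` placed in
that row, are exactly what `hσ` supplies. -/
theorem commute_pathLabels_two_three [Fact p.Prime] (hq : ∀ j, Commute q (a j))
    (hσ : ∀ j, a j ^ p * q⁻¹ * σ j = σ j * (a (j + 1) ^ p * q⁻¹)) :
    Commute (pathLabels p q a σ 2) (pathLabels p q a σ 3) := by
  refine RegularWreathProduct.ext (funext fun c => ?_) (mul_comm _ _)
  obtain ⟨⟨j, i⟩, rfl⟩ := ofAdd.surjective c
  simp only [pathLabels, mul_left_apply, Matrix.cons_val, ← ofAdd_neg, ← ofAdd_add, toAdd_ofAdd,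
    Prod.neg_mk, Prod.mk_add_mk, neg_neg, neg_zero, zero_add]
  simp only [add_comm (1 : ZMod p)]
  have hp := (Fact.out : p.Prime).two_le
  have : Fact (1 < p) := ⟨hp⟩
  have hi := ZMod.val_lt i
  by_cases h : i = -1
  · have hval : i.val + 1 = p := by
      obtain ⟨n, rfl⟩ : ∃ n, p = n + 1 := ⟨p - 1, by omega⟩
      rw [h, ZMod.val_neg_one]
    rw [if_pos h, if_pos h, h, neg_add_cancel, ← h, ZMod.val_zero, pow_zero, pow_zero, inv_one,
      one_mul, mul_one]
    have hs : a j ^ (i.val + 1) * q⁻¹ * σ j = σ j * (a (j + 1) ^ (i.val + 1) * q⁻¹) := by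
      simpa only [hval] using hσ j
    rw [pow_succ', pow_succ, mul_assoc (_ ^ _) (a (j + 1)),
      ← ((hq (j + 1)).inv_left).eq] at hs
    have e : (a j ^ i.val)⁻¹ * σ j * a (j + 1) ^ i.val * (q⁻¹ * a (j + 1)) =
        (a j ^ i.val)⁻¹ * (σ j * (a (j + 1) ^ i.val * (q⁻¹ * a (j + 1)))) := by group
    rw [e, ← hs, ((hq j).inv_left).eq, ← pow_succ', pow_succ]
    group
  · have hval : (i + 1).val = i.val + 1 := by
      have hne : i.val + 1 ≠ p := by
        intro hip
        apply h
        rw [eq_neg_iff_add_eq_zero, ← ZMod.natCast_zmod_val i]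
        have := congrArg (Nat.cast : ℕ → ZMod p) hip
        rwa [Nat.cast_add, Nat.cast_one, ZMod.natCast_self] at this
      rw [ZMod.val_add_of_lt] <;> rw [ZMod.val_one]
      omega
    rw [if_neg h, if_neg h, hval, pow_succ (a j), pow_succ (a (j + 1))]
    group

/-- The path visits rows `n, …, 1` and misses row `0`, the only one labelled `q`. A full turn from
row `0` therefore collects `q` exactly once. -/
theorem pathLabels_one_pow_left [Fact p.Prime] (j : ZMod p) (n : ℕ) (hn : n < p) :
    (pathLabels p q a σ 1 ^ n).left (ofAdd (j, (n : ZMod p))) = 1 := by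
  induction n with
  | zero => rfl
  | succ n ih =>
    have hne : ((n + 1 : ℕ) : ZMod p) ≠ 0 := by
      rw [Ne, ZMod.natCast_eq_zero_iff]
      exact Nat.not_dvd_of_pos_of_lt n.succ_pos hn
    have hpt : (pathLabels p q a σ 1).right⁻¹ * ofAdd (j, ((n + 1 : ℕ) : ZMod p)) =
        ofAdd (j, (n : ZMod p)) := by
      simp [pathLabels, ← ofAdd_neg, ← ofAdd_add]
    rw [pow_succ', mul_left_apply, hpt, ih (by omega), mul_one]
    simp only [pathLabels, Matrix.cons_val, toAdd_ofAdd]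
    rw [if_neg hne]

theorem pathLabels_one_pow_left_one [Fact p.Prime] :
    (pathLabels p q a σ 1 ^ p).left 1 = q := by
  have hp := (Fact.out : p.Prime).pos
  obtain ⟨n, hn⟩ : ∃ n, p = n + 1 := ⟨p - 1, by omega⟩
  have hpt : (pathLabels p q a σ 1).right⁻¹ * 1 = ofAdd ((0 : ZMod p), (n : ZMod p)) := by
    have : (n : ZMod p) = -1 := by
      rw [eq_neg_iff_add_eq_zero]
      have := ZMod.natCast_self p
      rwa [congrArg (Nat.cast : ℕ → ZMod p) hn, Nat.cast_add, Nat.cast_one] at this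
    simp [pathLabels, ← ofAdd_neg, this]
  have h := pathLabels_one_pow_left (q := q) (a := a) (σ := σ) (0 : ZMod p) n (by omega)
  have e : pathLabels p q a σ 1 ^ p = pathLabels p q a σ 1 * pathLabels p q a σ 1 ^ n := by
    rw [← pow_succ', ← hn]
  rw [e, mul_left_apply, hpt, h, mul_one]
  simp [pathLabels]

end Wreath

/-! ### Maps from the path group to finite `p`-groups. -/

section PathGroup

open Multiplicative RegularWreathProduct RightAngledArtinProP

variable {p : ℕ}

theorem RightAngledArtinProP.commute_gen {V : Type*} [Finite V] {Γ : SimpleGraph V} {u v : V}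
    (h : Γ.Adj u v) : Commute (gen p Γ u) (gen p Γ v) := by
  have : Commute (PresentedGroup.of u : RightAngledArtinGroup Γ) (PresentedGroup.of v) := by
    rw [← commutatorElement_eq_one_iff_commute]
    exact PresentedGroup.one_of_mem ⟨u, v, h, rfl⟩
  exact this.map (ProPCompletion.of p _)

variable [Fact p.Prime]

theorem RightAngledArtinProP.exists_monoidHom {V : Type*} [Finite V] {Γ : SimpleGraph V}
    {L : Type*} [Group L] [Finite L] (hL : IsPGroup p L) (l : V → L)
    (hl : ∀ u v, Γ.Adj u v → Commute (l u) (l v)) :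
    ∃ ψ : RightAngledArtinProP p Γ →* L,
      IsOpen (ψ.ker : Set (RightAngledArtinProP p Γ)) ∧ ∀ v, ψ (gen p Γ v) = l v := by
  have hrel : ∀ r ∈ {r : FreeGroup V | ∃ u v : V, Γ.Adj u v ∧
      r = ⁅FreeGroup.of u, FreeGroup.of v⁆}, FreeGroup.lift l r = 1 := by
    rintro _ ⟨u, v, h, rfl⟩
    rw [map_commutatorElement, FreeGroup.lift_apply_of, FreeGroup.lift_apply_of,
      commutatorElement_eq_one_iff_commute]
    exact hl u v h
  obtain ⟨ψ, hψ, h⟩ := ProPCompletion.exists_monoidHom hL (PresentedGroup.toGroup hrel)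
  exact ⟨ψ, hψ, fun v => (h _).trans (PresentedGroup.toGroup.of hrel)⟩

theorem commute_pathLabels {K : Type*} [Group K] {q : K} {a σ : ZMod p → K}
    (hq : ∀ j, Commute q (a j))
    (hσ : ∀ j, a j ^ p * q⁻¹ * σ j = σ j * (a (j + 1) ^ p * q⁻¹)) (u v : Fin 4)
    (h : (SimpleGraph.pathGraph 4).Adj u v) :
    Commute (pathLabels p q a σ u) (pathLabels p q a σ v) := by
  have h01 := commute_pathLabels_zero_one (p := p) (q := q) (a := a) (σ := σ)
  have h12 := commute_pathLabels_one_two (σ := σ) hq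
  have h23 := commute_pathLabels_two_three hq hσ
  rw [SimpleGraph.pathGraph_adj] at h
  fin_cases u <;> fin_cases v <;> simp at h <;>
    first | exact h01 | exact h12 | exact h23 | exact h01.symm | exact h12.symm | exact h23.symm

end PathGroup

/-! ### The subgroup `V` and maps out of it. -/

section HNNSubgroup

open Multiplicative RegularWreathProduct RightAngledArtinProP

variable (p : ℕ)

/-- The right-angled Artin pro-`p` group of the path with four vertices. -/
abbrev PathArtinProP : Type := RightAngledArtinProP p (SimpleGraph.pathGraph 4)

/-- The generators `yz`, `yz^x`, `y^p`, `wx` of the subgroup `V` of the right-angled Artin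
pro-`p` group of the path `x, y, z, w`. -/
def hnnGen : Fin 4 → PathArtinProP p :=
  ![gen p _ 1 * gen p _ 2, gen p _ 1 * ((gen p _ 0)⁻¹ * gen p _ 2 * gen p _ 0), gen p _ 1 ^ p,
    gen p _ 3 * gen p _ 0]

/-- The closed subgroup `⟨yz, yz^x, y^p, wx⟩`. -/
abbrev hnnSubgroup : Subgroup (PathArtinProP p) :=
  closedSubgroupGenerated (Set.range (hnnGen p))

/-- The generators of `hnnSubgroup`, as elements of it. -/
def hnnSubgroupGen (i : Fin 4) : hnnSubgroup p :=
  ⟨hnnGen p i, subset_closedSubgroupGenerated _ ⟨i, rfl⟩⟩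

theorem closedSubgroupGenerated_range_hnnSubgroupGen :
    closedSubgroupGenerated (Set.range (hnnSubgroupGen p)) = ⊤ := by
  rw [← closedSubgroupGenerated_preimage_eq_top]
  congr 1
  ext v
  constructor
  · rintro ⟨i, rfl⟩
    exact ⟨i, rfl⟩
  · rintro ⟨i, h⟩
    exact ⟨i, Subtype.ext h⟩

theorem hnnSubgroup_isProP [Fact p.Prime] : IsProP p (hnnSubgroup p) :=
  (ProPCompletion.isProP p _).subgroup (isClosed_closedSubgroupGenerated _)

variable {p} [Fact p.Prime]

theorem exists_monoidHom_hnnSubgroup_of_isPGroup {K : Type*} [Group K] [Finite K]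
    (hK : IsPGroup p K) {a b q s : K} (hqa : Commute q a) (hqb : Commute q b)
    (hs : s⁻¹ * (a ^ p * q⁻¹) * s = b ^ p * q⁻¹) :
    ∃ ψ : hnnSubgroup p →* K, IsOpen (ψ.ker : Set (hnnSubgroup p)) ∧
      ∀ i, ψ (hnnSubgroupGen p i) = ![a, b, q, s] i := by
  have hs' : a ^ p * q⁻¹ * s = s * (b ^ p * q⁻¹) := by rw [← hs]; group
  have hs'' : b ^ p * q⁻¹ * s⁻¹ = s⁻¹ * (a ^ p * q⁻¹) := by rw [← hs]; group
  -- Column `0` must carry `a` and column `1` must carry `b`. Going round the columns, `s` leads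
  -- from `a` to `b`, `s⁻¹` leads back, and `1` serves elsewhere; this is consistent also for `p =
  -- 2`.
  let α : ZMod p → K := fun j => if j = 1 then b else a
  let σ : ZMod p → K := fun j => if j = 0 then s else if j = 1 then s⁻¹ else 1
  have hα0 : α 0 = a := if_neg zero_ne_one
  have hα1 : α 1 = b := if_pos rfl
  have hq : ∀ j, Commute q (α j) := fun j => by
    simp only [α]
    split_ifs
    exacts [hqb, hqa]
  have hσ : ∀ j, α j ^ p * q⁻¹ * σ j = σ j * (α (j + 1) ^ p * q⁻¹) := fun j => by
    rcases eq_or_ne j 0 with rfl | h0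
    · simpa [α, σ] using hs'
    rcases eq_or_ne j 1 with rfl | h1
    · simpa [α, σ] using hs''
    simp [α, σ, h0, h1]
  have hQ : IsPGroup p (Multiplicative (ZMod p × ZMod p)) :=
    IsPGroup.of_card (n := 2) (by simp [pow_two])
  obtain ⟨Ψ, hΨ, hΨg⟩ := RightAngledArtinProP.exists_monoidHom
    (RegularWreathProduct.isPGroup hK hQ) _ (commute_pathLabels hq hσ)
  let U : Subgroup (PathArtinProP p) := (rightHom.comp Ψ).ker
  have hU : IsOpen (U : Set (PathArtinProP p)) :=
    Subgroup.isOpen_mono (H₁ := Ψ.ker) (fun g hg => by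
      rw [MonoidHom.mem_ker] at hg
      change rightHom (Ψ g) = 1
      rw [hg, map_one]) hΨ
  -- Elements of `V` are loops at every vertex of the covering, so reading off their label at `1` is
  -- multiplicative.
  have hle : hnnSubgroup p ≤ U := by
    refine closedSubgroupGenerated_le ?_ (Subgroup.isClosed_of_isOpen _ hU)
    rintro _ ⟨i, rfl⟩
    change rightHom (Ψ (hnnGen p i)) = 1
    have hexp : ∀ c : Multiplicative (ZMod p × ZMod p), c ^ p = 1 := fun c =>
      toAdd.injective (Prod.ext (by simp) (by simp))
    fin_cases i
    · simp [hnnGen, hΨg, pathLabels, ← ofAdd_add]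
    · simp [hnnGen, hΨg, pathLabels, ← ofAdd_neg, ← ofAdd_add]
    · change rightHom (Ψ (gen p _ 1 ^ p)) = 1
      rw [map_pow, map_pow, hexp]
    · simp [hnnGen, hΨg, pathLabels, ← ofAdd_add]
  let r : hnnSubgroup p →* (rightHom : K ≀ᵣ Multiplicative (ZMod p × ZMod p) →* _).ker :=
    (Ψ.comp (hnnSubgroup p).subtype).codRestrict _ fun v => hle v.2
  refine ⟨(leftOne _ _).comp r, ?_, fun i => ?_⟩
  · refine Subgroup.isOpen_mono (H₁ := Ψ.ker.comap (hnnSubgroup p).subtype) (fun g hg => ?_)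
      (hΨ.preimage continuous_subtype_val)
    have : r g = 1 := Subtype.ext hg
    rw [MonoidHom.mem_ker, MonoidHom.comp_apply, this, map_one]
  · change (Ψ (hnnGen p i)).left 1 = _
    fin_cases i
    · simp [hnnGen, hΨg, pathLabels, ← ofAdd_neg, hα0]
    · simp [hnnGen, hΨg, pathLabels, ← ofAdd_neg, hα1]
    · simp [hnnGen, hΨg, pathLabels_one_pow_left_one]
    · simp [hnnGen, hΨg, pathLabels, σ]

theorem exists_continuousMonoidHom_hnnSubgroup {K : Type*} [Group K] [TopologicalSpace K]
    (hK : IsProP p K) {a b q s : K} (hqa : Commute q a) (hqb : Commute q b)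
    (hs : s⁻¹ * (a ^ p * q⁻¹) * s = b ^ p * q⁻¹) :
    ∃ ψ : hnnSubgroup p →ₜ* K, ∀ i, ψ (hnnSubgroupGen p i) = ![a, b, q, s] i := by
  have hV := hnnSubgroup_isProP p
  have := hV.compactSpace
  have := hV.t2Space
  have := hK.isTopologicalGroup
  have := hK.compactSpace
  refine hK.exists_continuousMonoidHom _ _ (closedSubgroupGenerated_range_hnnSubgroupGen p) ?_
  intro N _ hN
  have : Finite (K ⧸ N) := Subgroup.quotient_finite_of_isOpen N hN
  obtain ⟨ψ, hψ, h⟩ := exists_monoidHom_hnnSubgroup_of_isPGroup (hK.isPGroup_quotient N hN)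
    (hqa.map (QuotientGroup.mk' N)) (hqb.map (QuotientGroup.mk' N))
    (s := QuotientGroup.mk' N s) (by simpa using congrArg (QuotientGroup.mk' N) hs)
  refine ⟨ψ, hψ, fun i => ?_⟩
  rw [h]
  fin_cases i <;> rfl

end HNNSubgroup

/-! ### `p`-adic powers in pro-`p` groups. -/

section PadicPowers

open Filter Multiplicative Topology

variable {p : ℕ} [Fact p.Prime]

theorem ZMod.exists_monoidHom_of_pow_eq_one {A : Type*} [Group A] {n : ℕ} {a : A}
    (ha : a ^ n = 1) : ∃ c : Multiplicative (ZMod n) →* A, c (ofAdd 1) = a := by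
  have h : zmultiplesHom _ (Additive.ofMul a) (n : ℤ) = 0 := by
    rw [zmultiplesHom_apply, natCast_zsmul]
    exact ha
  refine ⟨AddMonoidHom.toMultiplicativeLeft (ZMod.lift n ⟨_, h⟩), ?_⟩
  have h1 := ZMod.lift_coe n ⟨_, h⟩ 1
  rw [Int.cast_one] at h1
  change (ZMod.lift n ⟨_, h⟩ 1).toMul = a
  rw [h1]
  exact zpow_one a

theorem PadicInt.isOpen_ker_toZModPow (n : ℕ) :
    IsOpen ((PadicInt.toZModPow n : ℤ_[p] →+* ZMod (p ^ n)).toAddMonoidHom.ker : Set ℤ_[p]) := by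
  have h : ((PadicInt.toZModPow n : ℤ_[p] →+* ZMod (p ^ n)).toAddMonoidHom.ker : Set ℤ_[p]) =
      Metric.closedBall 0 ((p : ℝ) ^ (-n : ℤ)) := by
    ext x
    rw [mem_closedBall_zero_iff, PadicInt.norm_le_pow_iff_mem_span_pow, ← PadicInt.ker_toZModPow]
    rfl
  rw [h]
  refine IsUltrametricDist.isOpen_closedBall _ ?_
  exact (zpow_pos (by exact_mod_cast (Fact.out : p.Prime).pos) _).ne'

theorem PadicInt.closedSubgroupGenerated_ofAdd_one :
    closedSubgroupGenerated (Set.range fun _ : Unit => ofAdd (1 : ℤ_[p])) = ⊤ := by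
  rw [eq_top_iff]
  rintro x -
  refine closure_mono ?_ (PadicInt.denseRange_intCast (toAdd x) :
    toAdd x ∈ closure (Set.range (Int.cast : ℤ → ℤ_[p])))
  rintro _ ⟨n, rfl⟩
  have h : ofAdd ((n : ℤ) : ℤ_[p]) = ofAdd 1 ^ n := by
    rw [← ofAdd_zsmul, zsmul_one]
  change ofAdd ((n : ℤ) : ℤ_[p]) ∈
    Subgroup.closure (Set.range fun _ : Unit => ofAdd (1 : ℤ_[p]))
  rw [h]
  refine Subgroup.zpow_mem _ ?_ n
  exact Subgroup.subset_closure (Set.mem_range_self ())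

theorem PadicInt.monoidHom_ext {K : Type*} [Group K] [TopologicalSpace K] [T2Space K]
    {f g : Multiplicative ℤ_[p] →* K} (hf : Continuous f) (hg : Continuous g)
    (h : f (ofAdd 1) = g (ofAdd 1)) : f = g := by
  refine MonoidHom.ext fun x => ?_
  refine MonoidHom.eqOn_closedSubgroupGenerated hf hg (S := Set.range fun _ : Unit => ofAdd 1) ?_
    (PadicInt.closedSubgroupGenerated_ofAdd_one (p := p) ▸ Subgroup.mem_top x)
  rintro _ ⟨_, rfl⟩
  exact h

theorem IsProP.exists_padicPow {K : Type*} [Group K] [TopologicalSpace K] (hK : IsProP p K)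
    (k : K) : ∃ ψ : Multiplicative ℤ_[p] →ₜ* K, ψ (ofAdd 1) = k := by
  have := hK.isTopologicalGroup
  have : CompactSpace (Multiplicative ℤ_[p]) := inferInstanceAs (CompactSpace ℤ_[p])
  obtain ⟨ψ, h⟩ := hK.exists_continuousMonoidHom (fun _ : Unit => ofAdd (1 : ℤ_[p]))
    (fun _ => k) PadicInt.closedSubgroupGenerated_ofAdd_one (by
      intro N _ hN
      obtain ⟨n, hn⟩ := hK.index_eq_pow N ‹_› hN
      have hk : (k : K ⧸ N) ^ p ^ n = 1 := by
        rw [← hn, ← QuotientGroup.mk_pow]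
        exact (QuotientGroup.eq_one_iff _).2 (N.pow_index_mem k)
      obtain ⟨κ, hκ⟩ := ZMod.exists_monoidHom_of_pow_eq_one hk
      let τ : ℤ_[p] →+ ZMod (p ^ n) := (PadicInt.toZModPow n).toAddMonoidHom
      refine ⟨κ.comp (AddMonoidHom.toMultiplicative τ), ?_, fun _ => ?_⟩
      · refine Subgroup.isOpen_mono (H₁ := AddSubgroup.toSubgroup τ.ker) (fun x hx => ?_)
          (PadicInt.isOpen_ker_toZModPow n)
        have hx' : τ (toAdd x) = 0 := hx
        change κ (ofAdd (τ (toAdd x))) = 1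
        rw [hx', ofAdd_zero, map_one]
      · change κ (ofAdd (PadicInt.toZModPow n 1)) = (k : K ⧸ N)
        rw [map_one, hκ])
  exact ⟨ψ, h ()⟩

variable (p) in
theorem isProP_padicInt_prod_zmod :
    IsProP p (Multiplicative (ℤ_[p] × ℤ_[p] × ℤ_[p] × ZMod p)) := by
  have : CompactSpace (Multiplicative (ℤ_[p] × ℤ_[p] × ℤ_[p] × ZMod p)) :=
    inferInstanceAs (CompactSpace (ℤ_[p] × ℤ_[p] × ℤ_[p] × ZMod p))
  have : T2Space (Multiplicative (ℤ_[p] × ℤ_[p] × ℤ_[p] × ZMod p)) :=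
    inferInstanceAs (T2Space (ℤ_[p] × ℤ_[p] × ℤ_[p] × ZMod p))
  have : TotallyDisconnectedSpace (Multiplicative (ℤ_[p] × ℤ_[p] × ℤ_[p] × ZMod p)) :=
    inferInstanceAs (TotallyDisconnectedSpace (ℤ_[p] × ℤ_[p] × ℤ_[p] × ZMod p))
  refine IsProP.of_tendsto_pow fun g => ?_
  have hZ : ∀ a : ℤ_[p], Tendsto (fun n : ℕ => p ^ n • a) atTop (𝓝 0) := fun a => by
    have hp : ‖(p : ℤ_[p])‖ < 1 := by
      rw [PadicInt.norm_p]
      exact inv_lt_one_of_one_lt₀ (by exact_mod_cast (Fact.out : p.Prime).one_lt)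
    have h := (tendsto_pow_atTop_nhds_zero_of_norm_lt_one hp).mul_const a
    simpa [nsmul_eq_mul] using h
  have hC : ∀ a : ZMod p, Tendsto (fun n : ℕ => p ^ n • a) atTop (𝓝 0) := fun a => by
    refine tendsto_const_nhds.congr' ?_
    filter_upwards [eventually_ge_atTop 1] with n hn
    obtain ⟨k, rfl⟩ := Nat.exists_eq_add_of_le hn
    simp [pow_add]
  exact (hZ g.toAdd.1).prodMk_nhds ((hZ g.toAdd.2.1).prodMk_nhds
    ((hZ g.toAdd.2.2.1).prodMk_nhds (hC g.toAdd.2.2.2)))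

end PadicPowers

/-! ### Relations in `V` and its abelianization. -/

section Abelianization

open Multiplicative RightAngledArtinProP

variable (p : ℕ)

theorem commute_hnnSubgroupGen (i : Fin 4) (hi : i = 0 ∨ i = 1) :
    Commute (hnnSubgroupGen p 2) (hnnSubgroupGen p i) := by
  have h10 : Commute (gen p (SimpleGraph.pathGraph 4) 1) (gen p _ 0) :=
    commute_gen (by simp [SimpleGraph.pathGraph_adj])
  have h12 : Commute (gen p (SimpleGraph.pathGraph 4) 1) (gen p _ 2) :=
    commute_gen (by simp [SimpleGraph.pathGraph_adj])
  have h : Commute (hnnGen p 2) (hnnGen p i) := by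
    rcases hi with rfl | rfl
    · exact ((Commute.refl _).mul_right h12).pow_left _
    · exact ((Commute.refl _).mul_right ((h10.inv_right.mul_right h12).mul_right h10)).pow_left _
  exact Subtype.ext h

theorem hnnGen_zero_pow :
    hnnGen p 0 ^ p * (hnnGen p 2)⁻¹ = gen p _ 2 ^ p := by
  have h12 : Commute (gen p (SimpleGraph.pathGraph 4) 1) (gen p _ 2) :=
    commute_gen (by simp [SimpleGraph.pathGraph_adj])
  change (gen p _ 1 * gen p _ 2) ^ p * (gen p _ 1 ^ p)⁻¹ = _
  rw [h12.mul_pow, (h12.pow_pow p p).eq, mul_inv_cancel_right]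

theorem hnnGen_one_pow :
    hnnGen p 1 ^ p * (hnnGen p 2)⁻¹ = ((gen p _ 0)⁻¹ * gen p _ 2 * gen p _ 0) ^ p := by
  have h10 : Commute (gen p (SimpleGraph.pathGraph 4) 1) (gen p _ 0) :=
    commute_gen (by simp [SimpleGraph.pathGraph_adj])
  have h12 : Commute (gen p (SimpleGraph.pathGraph 4) 1) (gen p _ 2) :=
    commute_gen (by simp [SimpleGraph.pathGraph_adj])
  have h := (h10.inv_right.mul_right h12).mul_right h10
  change (gen p _ 1 * ((gen p _ 0)⁻¹ * gen p _ 2 * gen p _ 0)) ^ p * (gen p _ 1 ^ p)⁻¹ = _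
  rw [h.mul_pow, (h.pow_pow p p).eq, mul_inv_cancel_right]

theorem inv_mul_pow_mul {G : Type*} [Group G] (x z : G) (n : ℕ) :
    (x⁻¹ * z * x) ^ n = x⁻¹ * z ^ n * x := by
  simpa using conj_pow (a := x⁻¹) (b := z) (i := n)

/-- The two sides are conjugates of `z^p`, by `wx` and by `x`; the factor `w` drops out because it
commutes with `z`. -/
theorem hnnSubgroupGen_conj [Fact p.Prime] :
    (hnnSubgroupGen p 3)⁻¹ * (hnnSubgroupGen p 0 ^ p * (hnnSubgroupGen p 2)⁻¹) *
      hnnSubgroupGen p 3 = hnnSubgroupGen p 1 ^ p * (hnnSubgroupGen p 2)⁻¹ := by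
  have h23 : Commute (gen p (SimpleGraph.pathGraph 4) 2) (gen p _ 3) :=
    commute_gen (by simp [SimpleGraph.pathGraph_adj])
  apply Subtype.ext
  change (gen p _ 3 * gen p _ 0)⁻¹ * (hnnGen p 0 ^ p * (hnnGen p 2)⁻¹) * (gen p _ 3 * gen p _ 0) =
    hnnGen p 1 ^ p * (hnnGen p 2)⁻¹
  rw [hnnGen_zero_pow, hnnGen_one_pow, inv_mul_pow_mul, mul_inv_rev]
  have h := (h23.pow_left p).eq
  simp only [mul_assoc]
  rw [← mul_assoc (gen p _ 2 ^ p) (gen p _ 3), h]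
  group

theorem nonempty_continuousMulEquiv_padicInt_prod_zmod [Fact p.Prime] {A : Type*} [CommGroup A]
    [TopologicalSpace A] [IsTopologicalGroup A] [CompactSpace A] [T2Space A] (g : Fin 4 → A)
    (hg : closedSubgroupGenerated (Set.range g) = ⊤)
    (he : ∀ i, ∃ e : Multiplicative ℤ_[p] →* A, Continuous e ∧ e (ofAdd 1) = g i)
    (htor : (g 0 / g 1) ^ p = 1)
    (θ : A →* Multiplicative (ℤ_[p] × ℤ_[p] × ℤ_[p] × ZMod p)) (hθ : Continuous θ)
    (hθg : ∀ i, θ (g i) = ![ofAdd (1, 0, 0, 1), ofAdd (1, 0, 0, 0), ofAdd (0, 1, 0, 0),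
      ofAdd (0, 0, 1, 0)] i) :
    Nonempty (A ≃ₜ* Multiplicative (ℤ_[p] × ℤ_[p] × ℤ_[p] × ZMod p)) := by
  have : T2Space (Multiplicative (ℤ_[p] × ℤ_[p] × ℤ_[p] × ZMod p)) :=
    inferInstanceAs (T2Space (ℤ_[p] × ℤ_[p] × ℤ_[p] × ZMod p))
  choose e hec he using he
  obtain ⟨c, hc⟩ := ZMod.exists_monoidHom_of_pow_eq_one htor
  -- The inverse of `θ`: `p`-adic powers of `g 1`, `g 2`, `g 3` on the free coordinates, and `g 0 /
  -- g 1`, killed by `p`, on the last one.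
  let χ : Multiplicative (ℤ_[p] × ℤ_[p] × ℤ_[p] × ZMod p) →* A :=
    { toFun := fun b => e 1 (ofAdd b.toAdd.1) * e 2 (ofAdd b.toAdd.2.1) *
        e 3 (ofAdd b.toAdd.2.2.1) * c (ofAdd b.toAdd.2.2.2)
      map_one' := by simp
      map_mul' := fun a b => by
        simp only [toAdd_mul, Prod.fst_add, Prod.snd_add, ofAdd_add, map_mul]
        rw [mul_mul_mul_comm (e 1 _), mul_mul_mul_comm (_ * _) (_ * _) (e 3 _),
          mul_mul_mul_comm (_ * _) (_ * _) (c _)] }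
  have hχ : Continuous χ := by
    refine Continuous.mul (Continuous.mul (Continuous.mul ?_ ?_) ?_) ?_
    · exact (hec 1).comp continuous_fst
    · exact (hec 2).comp (continuous_fst.comp continuous_snd)
    · exact (hec 3).comp (continuous_fst.comp (continuous_snd.comp continuous_snd))
    · exact (continuous_of_discreteTopology (f := fun b : ZMod p => c (ofAdd b))).comp
        (continuous_snd.comp (continuous_snd.comp continuous_snd))
  have hχθ : ∀ v, χ (θ v) = v := fun v => by
    refine MonoidHom.eqOn_closedSubgroupGenerated (f := χ.comp θ) (g := MonoidHom.id A)
      (hχ.comp hθ) continuous_id (S := Set.range g) ?_ (hg ▸ Subgroup.mem_top v)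
    rintro _ ⟨i, rfl⟩
    change χ (θ (g i)) = g i
    rw [hθg]
    fin_cases i <;> simp [χ, he, hc]
  have hsurj : Function.Surjective θ := by
    intro b
    let j₁ : ℤ_[p] →+ ℤ_[p] × ℤ_[p] × ℤ_[p] × ZMod p := AddMonoidHom.inl _ _
    let j₂ : ℤ_[p] →+ ℤ_[p] × ℤ_[p] × ℤ_[p] × ZMod p :=
      (AddMonoidHom.inr _ _).comp (AddMonoidHom.inl _ _)
    let j₃ : ℤ_[p] →+ ℤ_[p] × ℤ_[p] × ℤ_[p] × ZMod p :=
      (AddMonoidHom.inr _ _).comp ((AddMonoidHom.inr _ _).comp (AddMonoidHom.inl _ _))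
    let j₄ : ZMod p →+ ℤ_[p] × ℤ_[p] × ℤ_[p] × ZMod p :=
      (AddMonoidHom.inr _ _).comp ((AddMonoidHom.inr _ _).comp (AddMonoidHom.inr _ _))
    have h₁ : θ.comp (e 1) = AddMonoidHom.toMultiplicative j₁ := by
      refine PadicInt.monoidHom_ext (hθ.comp (hec 1))
        (show Continuous fun v : ℤ_[p] => (v, (0 : ℤ_[p] × ℤ_[p] × ZMod p)) by fun_prop) ?_
      rw [MonoidHom.comp_apply, he, hθg]
      rfl
    have h₂ : θ.comp (e 2) = AddMonoidHom.toMultiplicative j₂ := by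
      refine PadicInt.monoidHom_ext (hθ.comp (hec 2))
        (show Continuous fun v : ℤ_[p] => ((0 : ℤ_[p]), v, (0 : ℤ_[p] × ZMod p)) by fun_prop) ?_
      rw [MonoidHom.comp_apply, he, hθg]
      rfl
    have h₃ : θ.comp (e 3) = AddMonoidHom.toMultiplicative j₃ := by
      refine PadicInt.monoidHom_ext (hθ.comp (hec 3))
        (show Continuous fun v : ℤ_[p] => ((0 : ℤ_[p]), (0 : ℤ_[p]), v, (0 : ZMod p)) by fun_prop) ?_
      rw [MonoidHom.comp_apply, he, hθg]
      rfl
    have h₄ : ∀ d : ZMod p, θ ((g 0 / g 1) ^ d.val) = ofAdd (j₄ d) := fun d => by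
      rw [map_pow, map_div, hθg, hθg]
      refine toAdd.injective ?_
      simp [j₄]
    refine ⟨e 1 (ofAdd b.toAdd.1) * e 2 (ofAdd b.toAdd.2.1) * e 3 (ofAdd b.toAdd.2.2.1) *
      (g 0 / g 1) ^ b.toAdd.2.2.2.val, ?_⟩
    rw [map_mul, map_mul, map_mul, h₄, ← MonoidHom.comp_apply, h₁, ← MonoidHom.comp_apply, h₂,
      ← MonoidHom.comp_apply, h₃]
    refine toAdd.injective ?_
    simp [j₁, j₂, j₃, j₄]
  have hbij : Function.Bijective θ := ⟨Function.LeftInverse.injective hχθ, hsurj⟩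
  exact ⟨{ MulEquiv.ofBijective θ hbij with
    continuous_toFun := hθ
    continuous_invFun := Continuous.continuous_symm_of_equiv_compact_to_t2
      (f := (MulEquiv.ofBijective θ hbij).toEquiv) hθ }⟩

theorem closedSubgroupGenerated_range_comp_eq_top {G A ι : Type*} [Group G] [TopologicalSpace G]
    [IsTopologicalGroup G] [Group A] [TopologicalSpace A] [IsTopologicalGroup A] {f : G →* A}
    (hf : Continuous f) (hsurj : Function.Surjective f) {g : ι → G}
    (hg : closedSubgroupGenerated (Set.range g) = ⊤) :
    closedSubgroupGenerated (Set.range fun i => f (g i)) = ⊤ := by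
  rw [eq_top_iff]
  rintro a -
  obtain ⟨v, rfl⟩ := hsurj a
  have hle : closedSubgroupGenerated (Set.range g) ≤
      (closedSubgroupGenerated (Set.range fun i => f (g i))).comap f := by
    refine closedSubgroupGenerated_le ?_ ((isClosed_closedSubgroupGenerated _).preimage hf)
    rintro _ ⟨i, rfl⟩
    exact subset_closedSubgroupGenerated _ ⟨i, rfl⟩
  exact hle (hg ▸ Subgroup.mem_top v)

theorem nonempty_topologicalAbelianization_hnnSubgroup [Fact p.Prime] :
    Nonempty (TopologicalAbelianization (hnnSubgroup p) ≃ₜ*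
      Multiplicative (ℤ_[p] × ℤ_[p] × ℤ_[p] × ZMod p)) := by
  have hV := hnnSubgroup_isProP p
  have := hV.compactSpace
  have hB := isProP_padicInt_prod_zmod p
  have := hB.t2Space
  have : IsClosed ((commutator (hnnSubgroup p)).topologicalClosure : Set (hnnSubgroup p)) :=
    Subgroup.isClosed_topologicalClosure _
  have hmk : Continuous (QuotientGroup.mk' (commutator (hnnSubgroup p)).topologicalClosure) :=
    continuous_quotient_mk'
  obtain ⟨θ₀, hθ₀⟩ := exists_continuousMonoidHom_hnnSubgroup hB
    (a := ofAdd (1, 0, 0, 1)) (b := ofAdd (1, 0, 0, 0)) (q := ofAdd (0, 1, 0, 0))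
    (s := ofAdd (0, 0, 1, 0)) (Commute.all _ _) (Commute.all _ _) (by
      rw [mul_right_comm, inv_mul_cancel, one_mul]
      refine toAdd.injective ?_
      simp)
  have hker : (commutator (hnnSubgroup p)).topologicalClosure ≤ θ₀.toMonoidHom.ker :=
    Subgroup.topologicalClosure_minimal _ (Abelianization.commutator_subset_ker _)
      ((isClosed_singleton (x := 1)).preimage θ₀.continuous_toFun)
  refine nonempty_continuousMulEquiv_padicInt_prod_zmod p
    (fun i => QuotientGroup.mk' _ (hnnSubgroupGen p i))
    (closedSubgroupGenerated_range_comp_eq_top hmk (QuotientGroup.mk'_surjective _)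
      (closedSubgroupGenerated_range_hnnSubgroupGen p)) (fun i => ?_) ?_
    (QuotientGroup.lift _ θ₀.toMonoidHom hker) (θ₀.continuous_toFun.quotient_lift _) hθ₀
  · obtain ⟨e, he⟩ := hV.exists_padicPow (hnnSubgroupGen p i)
    exact ⟨(QuotientGroup.mk' _).comp e.toMonoidHom, hmk.comp e.continuous_toFun,
      congrArg (QuotientGroup.mk' _) he⟩
  · have h := congrArg (QuotientGroup.mk' (commutator (hnnSubgroup p)).topologicalClosure)
      (hnnSubgroupGen_conj p)
    simp only [map_mul, map_inv, map_pow] at h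
    rw [mul_right_comm, inv_mul_cancel, one_mul] at h
    rw [div_pow, div_eq_one]
    exact mul_right_cancel h

end Abelianization

/-! ### The HNN structure on `V`. -/

section HNNExtension

open RightAngledArtinProP

variable (p : ℕ)

/-- The closed subgroup `⟨yz, yz^x, y^p⟩`. -/
abbrev hnnBase : Subgroup (PathArtinProP p) :=
  closedSubgroupGenerated {hnnGen p 0, hnnGen p 1, hnnGen p 2}

theorem hnnBase_le : hnnBase p ≤ hnnSubgroup p := by
  refine closedSubgroupGenerated_le ?_ (isClosed_closedSubgroupGenerated _)
  rintro _ (rfl | rfl | rfl) <;> exact subset_closedSubgroupGenerated _ ⟨_, rfl⟩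

/-- The inclusion of `hnnBase` in `hnnSubgroup`. -/
def hnnInclusion : hnnBase p →ₜ* hnnSubgroup p where
  toMonoidHom := Subgroup.inclusion (hnnBase_le p)
  continuous_toFun := continuous_inclusion (hnnBase_le p)

theorem exists_isProPHNNExtension [Fact p.Prime] :
    ∃ (a b : hnnBase p) (f : closedSubgroupGenerated {a} →ₜ* hnnBase p),
      (a : PathArtinProP p) = gen p _ 2 ^ p ∧
      (b : PathArtinProP p) = ((gen p _ 0)⁻¹ * gen p _ 2 * gen p _ 0) ^ p ∧
      (∀ c : closedSubgroupGenerated {a}, (c : hnnBase p) = a → f c = b) ∧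
      IsProPHNNExtension.{u} p (closedSubgroupGenerated {a}) f (hnnInclusion p)
        (hnnSubgroupGen p 3) := by
  have hG : IsProP p (PathArtinProP p) := ProPCompletion.isProP p _
  have := hG.t2Space
  have hmem : ∀ i, i = 0 ∨ i = 1 ∨ i = 2 → hnnGen p i ∈ hnnBase p := fun i hi =>
    subset_closedSubgroupGenerated _ (by rcases hi with rfl | rfl | rfl <;> simp)
  let u : hnnBase p := ⟨hnnGen p 0, hmem 0 (by simp)⟩
  let v : hnnBase p := ⟨hnnGen p 1, hmem 1 (by simp)⟩
  let q : hnnBase p := ⟨hnnGen p 2, hmem 2 (by simp)⟩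
  have hqu : Commute q u := Subtype.ext
    ((commute_hnnSubgroupGen p 0 (.inl rfl)).map (hnnSubgroup p).subtype).eq
  have hqv : Commute q v := Subtype.ext
    ((commute_hnnSubgroupGen p 1 (.inr rfl)).map (hnnSubgroup p).subtype).eq
  let a : hnnBase p := u ^ p * q⁻¹
  let b : hnnBase p := v ^ p * q⁻¹
  have ha : (a : PathArtinProP p) = gen p _ 2 ^ p := hnnGen_zero_pow p
  have hb : (b : PathArtinProP p) = ((gen p _ 0)⁻¹ * gen p _ 2 * gen p _ 0) ^ p :=
    hnnGen_one_pow p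
  let A : Subgroup (hnnBase p) := closedSubgroupGenerated {a}
  -- The associated map is conjugation by `x` in `G`, so continuity and injectivity come for free.
  -- Only its values in `V₁` need an argument, by generation from `a` and closedness of `V₁`.
  let τ : A →* PathArtinProP p :=
    (MulAut.conj (gen p (SimpleGraph.pathGraph 4) 0)⁻¹).toMonoidHom.comp
      ((hnnBase p).subtype.comp A.subtype)
  have hτ : ∀ c : A, τ c =
      (gen p _ 0)⁻¹ * ((c : hnnBase p) : PathArtinProP p) * gen p _ 0 := fun c => by
    change (gen p _ 0)⁻¹ * ((c : hnnBase p) : PathArtinProP p) * (gen p _ 0)⁻¹⁻¹ = _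
    rw [inv_inv]
  have hτc : Continuous τ := by
    rw [show (τ : A → PathArtinProP p) = _ from funext hτ]
    exact (continuous_const.mul (continuous_subtype_val.comp continuous_subtype_val)).mul
      continuous_const
  have hτa : ∀ c : A, (c : hnnBase p) = a → τ c = b := fun c hc => by
    rw [hτ, hc, ha, hb, inv_mul_pow_mul]
  have hτmem : ∀ c : A, τ c ∈ hnnBase p := by
    have hle : (⊤ : Subgroup A) ≤ (hnnBase p).comap τ := by
      rw [← closedSubgroupGenerated_preimage_eq_top]
      refine closedSubgroupGenerated_le ?_ ((isClosed_closedSubgroupGenerated _).preimage hτc)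
      intro c hc
      change τ c ∈ hnnBase p
      rw [hτa c hc]
      exact b.2
    exact fun c => hle (Subgroup.mem_top c)
  let f : A →ₜ* hnnBase p :=
    ⟨τ.codRestrict _ hτmem, hτc.subtype_mk hτmem⟩
  refine ⟨a, b, f, ha, hb, fun c hc => Subtype.ext (hτa c hc), ?_⟩
  have haA : a ∈ A := subset_closedSubgroupGenerated _ rfl
  have hfa : f ⟨a, haA⟩ = b := Subtype.ext (hτa _ rfl)
  refine ⟨hG.subgroup (isClosed_closedSubgroupGenerated _), hnnSubgroup_isProP p,
    isClosed_closedSubgroupGenerated _, fun c d hcd => ?_, fun c => ?_, ?_⟩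
  · have h : τ c = τ d := congrArg Subtype.val hcd
    rw [hτ, hτ] at h
    exact Subtype.ext (Subtype.ext (mul_left_cancel (mul_right_cancel h)))
  · have hV := (hnnSubgroup_isProP p).t2Space
    have key : Set.EqOn (((MulAut.conj (hnnSubgroupGen p 3)⁻¹).toMonoidHom.comp
        (hnnInclusion p).toMonoidHom).comp A.subtype)
        ((hnnInclusion p).comp f).toMonoidHom
        (closedSubgroupGenerated (Subtype.val ⁻¹' {a} : Set A)) := by
      refine MonoidHom.eqOn_closedSubgroupGenerated ?_
        ((hnnInclusion p).comp f).continuous_toFun ?_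
      · exact (continuous_const.mul ((hnnInclusion p).continuous_toFun.comp
          continuous_subtype_val)).mul continuous_const
      · rintro ⟨c, hc⟩ (rfl : c = a)
        change (hnnSubgroupGen p 3)⁻¹ * (hnnSubgroupGen p 0 ^ p * (hnnSubgroupGen p 2)⁻¹) *
          (hnnSubgroupGen p 3)⁻¹⁻¹ = hnnInclusion p (f ⟨a, haA⟩)
        rw [hfa, inv_inv, hnnSubgroupGen_conj]
        rfl
    have h := key (x := c) (by
      rw [closedSubgroupGenerated_preimage_eq_top]
      exact Subgroup.mem_top c)
    change (hnnSubgroupGen p 3)⁻¹ * hnnInclusion p c * (hnnSubgroupGen p 3)⁻¹⁻¹ = _ at h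
    rwa [inv_inv] at h
  · intro K _ _ hK φ s hs
    have := hK.t2Space
    have hs' : s⁻¹ * (φ u ^ p * (φ q)⁻¹) * s = φ v ^ p * (φ q)⁻¹ := by
      have h := hs ⟨a, haA⟩
      rw [hfa] at h
      simpa only [a, b, map_mul, map_pow, map_inv] using h
    obtain ⟨ψ, hψ⟩ := exists_continuousMonoidHom_hnnSubgroup hK (hqu.map φ) (hqv.map φ) hs'
    refine ⟨ψ, ⟨fun h => ?_, hψ 3⟩, fun ψ' hψ' => ?_⟩
    -- Since `φ` is already a homomorphism on `V₁`, agreement on three generators suffices; no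
    -- presentation of `V₁` is needed.
    · have key : ψ.comp (hnnInclusion p) = φ := by
        refine ContinuousMonoidHom.ext_of_closedSubgroupGenerated_eq_top
          (closedSubgroupGenerated_preimage_eq_top _) ?_
        rintro ⟨g, hg⟩ (rfl | rfl | rfl)
        exacts [hψ 0, hψ 1, hψ 2]
      exact DFunLike.congr_fun key h
    · refine ContinuousMonoidHom.ext_of_closedSubgroupGenerated_eq_top
        (closedSubgroupGenerated_range_hnnSubgroupGen p) ?_
      rintro _ ⟨i, rfl⟩
      rw [hψ]
      fin_cases i
      exacts [hψ'.1 u, hψ'.1 v, hψ'.1 q, hψ'.2]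

end HNNExtension

theorem theorem3p3 (p : ℕ) [Fact p.Prime]
    (x y z w : RightAngledArtinProP p (SimpleGraph.pathGraph 4))
    (hx : x = RightAngledArtinProP.gen p (SimpleGraph.pathGraph 4) 0)
    (hy : y = RightAngledArtinProP.gen p (SimpleGraph.pathGraph 4) 1)
    (hz : z = RightAngledArtinProP.gen p (SimpleGraph.pathGraph 4) 2)
    (hw : w = RightAngledArtinProP.gen p (SimpleGraph.pathGraph 4) 3)
    (V₁ V : Subgroup (RightAngledArtinProP p (SimpleGraph.pathGraph 4)))
    (hV₁ : V₁ = closedSubgroupGenerated {y * z, y * (x⁻¹ * z * x), y ^ p})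
    (hV : V = closedSubgroupGenerated {y * z, y * (x⁻¹ * z * x), y ^ p, w * x}) :
    ¬ IsAbsolutelyTorsionFree (RightAngledArtinProP p (SimpleGraph.pathGraph 4)) ∧
    (∃ (a b : V₁) (f : closedSubgroupGenerated {a} →ₜ* V₁) (ι : V₁ →ₜ* V) (t : V),
      (a : RightAngledArtinProP p (SimpleGraph.pathGraph 4)) = z ^ p ∧
      (b : RightAngledArtinProP p (SimpleGraph.pathGraph 4)) = (x⁻¹ * z * x) ^ p ∧
      (∀ c : closedSubgroupGenerated {a}, (c : V₁) = a → f c = b) ∧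
      (∀ v : V₁, (ι v : RightAngledArtinProP p (SimpleGraph.pathGraph 4)) = v) ∧
      (t : RightAngledArtinProP p (SimpleGraph.pathGraph 4)) = w * x ∧
      IsProPHNNExtension.{u} p (closedSubgroupGenerated {a}) f ι t) ∧
    Nonempty (TopologicalAbelianization V ≃ₜ*
      Multiplicative (ℤ_[p] × ℤ_[p] × ℤ_[p] × ZMod p)) := by
  have hV₁' : V₁ = hnnBase p := by
    rw [hV₁, hx, hy, hz]
    rfl
  have hV' : V = hnnSubgroup p := by
    rw [hV, hx, hy, hz, hw]
    congr 1
    simp only [hnnGen, Matrix.range_cons, Matrix.range_empty, Set.union_empty,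
      Set.singleton_union]
  clear hV₁ hV
  subst hV₁' hV' hx hy hz hw
  obtain ⟨e⟩ := nonempty_topologicalAbelianization_hnnSubgroup p
  refine ⟨fun h => ?_, ?_, ⟨e⟩⟩
  · have hfree := h (hnnSubgroup p) (isClosed_closedSubgroupGenerated _)
    have hp := (Fact.out : p.Prime).ne_zero
    -- The generator of the `C_p` factor is a nontrivial torsion element.
    have h1 : (e.symm (Multiplicative.ofAdd (0, 0, 0, 1))) ^ p = 1 ^ p := by
      rw [← map_pow, one_pow, ← map_one e.symm]
      exact congrArg e.symm (Multiplicative.toAdd.injective (by simp))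
    have h2 := pow_left_injective hp h1
    rw [← map_one e.symm, e.symm.injective.eq_iff] at h2
    exact one_ne_zero (congrArg (fun c => (Multiplicative.toAdd c).2.2.2) h2)
  · obtain ⟨a, b, f, ha, hb, hf, h⟩ := exists_isProPHNNExtension.{u} p
    exact ⟨a, b, f, hnnInclusion p, hnnSubgroupGen p 3, ha, hb, hf, fun _ => rfl, rfl, h⟩
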